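/- Let $n\ge 0$, let $\sigma\in B_n$ be an element of the Artin braid group with generators $\sigma_1,\dots,\sigma_{n-1}$, and let $w\in\mathbb Z$ be its writhe, i.e. its image under the homomorphism $B_n\to\mathbb Z$ with $\sigma_i\mapsto 1$. Let $\beta$ be any word in the $\sigma_i^{\pm1}$ representing $\sigma$, and let $\mathcal D\subset S^2\setminus\{\mathbb O,\mathbb X\}$ be the diagram of the annular closure $\widehat\sigma$ given by closing $\beta$ around $\mathbb X$, with the braid-like orientation $o_\uparrow$ (all strands wind counterclockwise about $\mathbb X$); $\sigma_i$ gives a positive crossing. Let $(\mathcal C,\partial^{Lee})$ be the Lee complex of $\mathcal D$ over $\mathbb C$. It has the distinguished basis of all resolutions of $\mathcal D$ with every circle marked $v_+$ or $v_-$, and its differential is the signed sum, over the edges of the cube of resolutions, of the merge maps $v_\pm\otimes v_\pm\mapsto v_+$, $v_\pm\otimes v_\mp\mapsto v_-$ and the split maps $v_+\mapsto v_+\otimes v_-+v_-\otimes v_+$, $v_-\mapsto v_-\otimes v_-+v_+\otimes v_+$. For a distinguished basis element $\mathbf x$ let $$j(\mathbf x)=\#v_+-\#v_-+\#\{1\text{-resolutions}\}+n_+-2n_-,$$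 where $n_\pm$ is the number of positive/negative crossings, let $k(\mathbf x)$ be the number of $v_+$ minus the number of $v_-$ on the nontrivial circles (those meeting an arc $\gamma$ from $\mathbb X$ to $\mathbb O$ that misses the crossings in an odd number of points), and for $t\in[0,2]$ let $j_t=j-t\,k$. For $0\ne x\in\mathcal C$ let $\mathrm{gr}_{j_t}(x)$ be the largest $a\in\mathbb R$ such that $x$ lies in the span of the distinguished basis elements with $j_t\ge a$, and for $0\neq\eta\in H_*(\mathcal C,\partial^{Lee})$ let $\mathrm{gr}_{j_t}(\eta)=\max\{\mathrm{gr}_{j_t}(z): [z]=\eta\}$. Let $\mathfrak s_{o_\uparrow}\in\mathcal C$ be Lee's canonical element: the oriented resolution of $(\mathcal D,o_\uparrow)$, consisting of $n$ nested circles, marked from the outermost to the innermost circle alternately by $\mathbf b=v_--v_+$ and $\mathbf a=v_-+v_+$, starting with $\mathbf b$. The annular Rasmussen invariant is $d_t(\widehat\sigma,o_\uparrow)=\mathrm{gr}_{j_t}([\mathfrak s_{o_\uparrow}])$. Then $\mathfrak s_{o_\uparrow}$ is a cycle, its homology class is nonzero, the maximum defining $d_1(\widehat\sigma,o_\uparrow)$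 exists, and $$d_1(\widehat\sigma,o_\uparrow)=w.$$ -/

import Mathlib

namespace AnnularLee

/-! ### Braid groups -/

/-- The Artin relations on the free group with generators `σ_0, …, σ_{n-2}`: far commutation and the
braid relation. -/
def braidRels (n : ℕ) : Set (FreeGroup (Fin (n - 1))) :=
  {r | ∃ i j : Fin (n - 1), (i : ℕ) + 1 < j ∧
      r = FreeGroup.of i * FreeGroup.of j * (FreeGroup.of j * FreeGroup.of i)⁻¹} ∪
  {r | ∃ i j : Fin (n - 1), (i : ℕ) + 1 = j ∧
      r = FreeGroup.of i * FreeGroup.of j * FreeGroup.of i *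
        (FreeGroup.of j * FreeGroup.of i * FreeGroup.of j)⁻¹}

/-- Artin's braid group `B_n` on `n` strands. -/
abbrev BraidGroup (n : ℕ) : Type := PresentedGroup (braidRels n)

/-- The writhe (exponent sum) homomorphism `B_n → ℤ`, sending every `σ_i` to `1`. -/
def writheHom (n : ℕ) : BraidGroup n →* Multiplicative ℤ :=
  PresentedGroup.toGroup (rels := braidRels n) (f := fun _ => Multiplicative.ofAdd 1) (by
    rintro r (⟨i, j, _, rfl⟩ | ⟨i, j, _, rfl⟩) <;> simp)

/-- The writhe of a braid. -/
def writhe {n : ℕ} (σ : BraidGroup n) : ℤ := Multiplicative.toAdd (writheHom n σ)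

/-- A word in the letters `σ_i = (i, true)` and `σ_i⁻¹ = (i, false)`. -/
abbrev BraidWord (n : ℕ) : Type := List (Fin (n - 1) × Bool)

/-- The braid represented by a word. -/
def BraidWord.toBraid {n : ℕ} (β : BraidWord n) : BraidGroup n :=
  PresentedGroup.mk (braidRels n) (FreeGroup.mk β)

/-! ### The annular closure of a braid word and its resolutions

The braid runs upwards; its `m = β.length` crossings sit between the `m + 1` levels `0, …, m`, the
`ℓ`-th crossing (between levels `ℓ` and `ℓ + 1`) being the `ℓ`-th letter of the word. The positions
`0, …, n - 1` at each level are numbered from left to right. The closure joins `(m, p)` to `(0, p)`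
by `n` nested parallel arcs passing to the left of the braid, around the basepoint `X`. Thus the
braid-like orientation winds counterclockwise about `X`, and the strand at position `p` lies
inside the strands at positions `q > p`. The arc `γ` from `X` to the outer basepoint `O` is chosen
to meet each of the `n` closing arcs once and to meet nothing else. -/

variable {n : ℕ}

/-- The left-hand strand position of the `ℓ`-th crossing. -/
def leftPos (β : BraidWord n) (ℓ : Fin β.length) : Fin n :=
  ⟨(β.get ℓ).1, by have := (β.get ℓ).1.isLt; omega⟩

/-- The right-hand strand position of the `ℓ`-th crossing. -/
def rightPos (β : BraidWord n) (ℓ : Fin β.length) : Fin n :=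
  ⟨(β.get ℓ).1 + 1, by have := (β.get ℓ).1.isLt; omega⟩

/-- A Kauffman state (complete resolution), i.e. a vertex of the cube of resolutions: `false` is the
`0`-resolution and `true` the `1`-resolution of a crossing. -/
abbrev State (β : BraidWord n) : Type := Fin β.length → Bool

/-- The braid-like (oriented) resolution of a positive crossing is its `0`-resolution, that of a
negative crossing is its `1`-resolution. The resolution of the crossing `ℓ` in the state `s` is
braid-like (two vertical arcs) if this holds; otherwise it consists of two horizontal arcs. -/
def IsVertical (β : BraidWord n) (s : State β) (ℓ : Fin β.length) : Prop :=
  s ℓ = !(β.get ℓ).2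

/-- The points `(level, position)` of the closed braid diagram. -/
abbrev Point (β : BraidWord n) : Type := Fin (β.length + 1) × Fin n

/-- The arcs of the resolution `s`, recorded by their end points. -/
inductive Arc (β : BraidWord n) (s : State β) : Point β → Point β → Prop
  | closing (p : Fin n) : Arc β s (Fin.last _, p) (0, p)
  | strand (ℓ : Fin β.length) (p : Fin n) (hl : p ≠ leftPos β ℓ) (hr : p ≠ rightPos β ℓ) :
      Arc β s (ℓ.castSucc, p) (ℓ.succ, p)
  | verticalLeft (ℓ : Fin β.length) (h : IsVertical β s ℓ) :
      Arc β s (ℓ.castSucc, leftPos β ℓ) (ℓ.succ, leftPos β ℓ)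
  | verticalRight (ℓ : Fin β.length) (h : IsVertical β s ℓ) :
      Arc β s (ℓ.castSucc, rightPos β ℓ) (ℓ.succ, rightPos β ℓ)
  | horizontalLower (ℓ : Fin β.length) (h : ¬ IsVertical β s ℓ) :
      Arc β s (ℓ.castSucc, leftPos β ℓ) (ℓ.castSucc, rightPos β ℓ)
  | horizontalUpper (ℓ : Fin β.length) (h : ¬ IsVertical β s ℓ) :
      Arc β s (ℓ.succ, leftPos β ℓ) (ℓ.succ, rightPos β ℓ)

/-- The circles of the resolution `s`: the classes of points under the equivalence relation
generated by being joined by an arc. -/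
def StateCircle (β : BraidWord n) (s : State β) : Type := Quot (Arc β s)

/-- The circle of the resolution `s` through a given point. -/
def circleAt (β : BraidWord n) (s : State β) (P : Point β) : StateCircle β s := Quot.mk _ P

instance (β : BraidWord n) (s : State β) : Finite (StateCircle β s) :=
  inferInstanceAs (Finite (Quot (Arc β s)))

noncomputable instance (β : BraidWord n) (s : State β) : Fintype (StateCircle β s) :=
  Fintype.ofFinite _

/-- A circle is nontrivial if it meets the arc `γ` in an odd number of points. -/
def IsNontrivial (β : BraidWord n) (s : State β) (c : StateCircle β s) : Prop :=
  Odd (Set.ncard {p : Fin n | circleAt β s (0, p) = c})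

/-! ### The Khovanov-Lee complex -/

/-- The distinguished basis elements: a resolution together with a marking of each of its circles
by `v₊` (written `1 : ℤˣ`) or `v₋` (written `-1 : ℤˣ`). -/
abbrev Generator (β : BraidWord n) : Type := Σ s : State β, (StateCircle β s → ℤˣ)

noncomputable instance (β : BraidWord n) : Fintype (Generator β) := Fintype.ofFinite _

/-- The marking of the circle through a point. -/
def Generator.mark {β : BraidWord n} (g : Generator β) (P : Point β) : ℤˣ :=
  g.2 (circleAt β g.1 P)

/-- The vector space underlying the Khovanov-Lee complex, with complex coefficients; the
coordinates of a chain are taken in the distinguished basis. -/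
abbrev Chain (β : BraidWord n) : Type := Generator β → ℂ

/-- The number of positive crossings. -/
def numPos (β : BraidWord n) : ℕ := β.countP fun x => x.2

/-- The number of negative crossings. -/
def numNeg (β : BraidWord n) : ℕ := β.countP fun x => !x.2

/-- The quantum grading `j` of a generator: number of `v₊` minus number of `v₋`, plus number of
`1`-resolutions, shifted by `n₊ - 2 n₋`. -/
noncomputable def jGrading {β : BraidWord n} (g : Generator β) : ℤ :=
  (∑ c, (g.2 c : ℤ)) + (Finset.univ.filter fun ℓ => g.1 ℓ = true).card +
    (numPos β : ℤ) - 2 * (numNeg β : ℤ)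

open Classical in
/-- The annular grading `k` of a generator: the algebraic intersection number with `γ` of the state
in which a circle marked `v₊` is oriented counterclockwise and one marked `v₋` clockwise. A
nontrivial circle contributes `±1` accordingly, a trivial circle contributes `0`. -/
noncomputable def kGrading {β : BraidWord n} (g : Generator β) : ℤ :=
  ∑ c, if IsNontrivial β g.1 c then (g.2 c : ℤ) else 0

/-- The grading `j_t = j - t k`. -/
noncomputable def jtGrading {β : BraidWord n} (t : ℝ) (g : Generator β) : ℝ :=
  (jGrading g : ℝ) - t * (kGrading g : ℝ)

/-- The lower left end of the crossing `ℓ`. In both resolutions of the crossing this point and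
`upperEnd` lie on different local arcs, and each of the two local arcs contains one of them. -/
def lowerEnd (β : BraidWord n) (ℓ : Fin β.length) : Point β := (ℓ.castSucc, leftPos β ℓ)

/-- The upper right end of the crossing `ℓ`. -/
def upperEnd (β : BraidWord n) (ℓ : Fin β.length) : Point β := (ℓ.succ, rightPos β ℓ)

/-- `g'` occurs in the image of `g` under the merge map of the crossing `ℓ`:
`v₊ ⊗ v₊ ↦ v₊`, `v₊ ⊗ v₋ ↦ v₋`, `v₋ ⊗ v₊ ↦ v₋`, `v₋ ⊗ v₋ ↦ v₊`
(the last one being the Lee deformation). -/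
def IsMergeTerm {β : BraidWord n} (ℓ : Fin β.length) (g g' : Generator β) : Prop :=
  circleAt β g.1 (lowerEnd β ℓ) ≠ circleAt β g.1 (upperEnd β ℓ) ∧
  circleAt β g'.1 (lowerEnd β ℓ) = circleAt β g'.1 (upperEnd β ℓ) ∧
  g'.mark (lowerEnd β ℓ) = g.mark (lowerEnd β ℓ) * g.mark (upperEnd β ℓ)

/-- `g'` occurs in the image of `g` under the split map of the crossing `ℓ`:
`v₊ ↦ v₊ ⊗ v₋ + v₋ ⊗ v₊`, `v₋ ↦ v₋ ⊗ v₋ + v₊ ⊗ v₊`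
(the last term being the Lee deformation). -/
def IsSplitTerm {β : BraidWord n} (ℓ : Fin β.length) (g g' : Generator β) : Prop :=
  circleAt β g.1 (lowerEnd β ℓ) = circleAt β g.1 (upperEnd β ℓ) ∧
  circleAt β g'.1 (lowerEnd β ℓ) ≠ circleAt β g'.1 (upperEnd β ℓ) ∧
  g'.mark (lowerEnd β ℓ) * g'.mark (upperEnd β ℓ) = -g.mark (lowerEnd β ℓ)

/-- `g'` occurs in the image of `g` under the map belonging to the edge of the cube that changes the
`0`-resolution of the crossing `ℓ` to its `1`-resolution: the circles away from the crossing keep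
their markings, those at the crossing merge or split. -/
def IsEdgeTerm {β : BraidWord n} (ℓ : Fin β.length) (g g' : Generator β) : Prop :=
  g.1 ℓ = false ∧ g'.1 = Function.update g.1 ℓ true ∧
  (∀ P : Point β, circleAt β g.1 P ≠ circleAt β g.1 (lowerEnd β ℓ) →
    circleAt β g.1 P ≠ circleAt β g.1 (upperEnd β ℓ) → g'.mark P = g.mark P) ∧
  (IsMergeTerm ℓ g g' ∨ IsSplitTerm ℓ g g')

open Classical in
/-- The matrix entry of the Lee differential from `g` to `g'`, with the usual cube sign. -/
noncomputable def leeCoeff {β : BraidWord n} (g g' : Generator β) : ℂ :=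
  ∑ ℓ : Fin β.length, if IsEdgeTerm ℓ g g' then
    (-1) ^ (Finset.univ.filter fun k => k < ℓ ∧ g.1 k = true).card else 0

/-- The Lee differential `∂ + Φ`. -/
noncomputable def leeDifferential (β : BraidWord n) : Chain β →ₗ[ℂ] Chain β :=
  Matrix.mulVecLin (Matrix.of fun g' g => leeCoeff g g')

/-! ### The filtrations and the annular Rasmussen invariants -/

open Classical in
/-- The piece at `a` of the filtration induced by `j_t`: the span of the distinguished basis
elements with `j_t ≥ a`. -/
noncomputable def filtration (β : BraidWord n) (t a : ℝ) : Submodule ℂ (Chain β) :=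
  Submodule.span ℂ {x | ∃ g : Generator β, a ≤ jtGrading t g ∧ x = Pi.single g 1}

/-- The `j_t`-filtration grading of a (nonzero) chain: the largest `a` such that the chain lies
in the piece at `a`. -/
noncomputable def chainGrading (β : BraidWord n) (t : ℝ) (x : Chain β) : ℝ :=
  sSup {a | x ∈ filtration β t a}

/-- The `j_t`-gradings of the cycles homologous to `x`. -/
def classGradings (β : BraidWord n) (t : ℝ) (x : Chain β) : Set ℝ :=
  {r | ∃ z, leeDifferential β z = 0 ∧ z - x ∈ LinearMap.range (leeDifferential β) ∧
    chainGrading β t z = r}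

/-- The braid-like resolution of the closed braid diagram. Its circles are the `n` nested closed
strands, one for every position. -/
def braidlikeState (β : BraidWord n) : State β := fun ℓ => !(β.get ℓ).2

/-- In the braid-like resolution with the orientation `o_↑`, all circles are counterclockwise.
The canonical marking of such a circle is `b` if it is separated from infinity by an even number of
circles, and `a` otherwise; the circle at position `p` is inside the circles at the positions
`q > p`. -/
def IsMarkedB (p : Fin n) : Prop := Even (Finset.univ.filter fun q : Fin n => p < q).card

open Classical in
/-- The canonical Lee cycle `𝔰_o` for the braid-like orientation `o = o_↑`: the circles of the
braid-like resolution are marked by `a = v₋ + v₊` or `b = v₋ - v₊`, alternately, starting with `b`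
for the outermost circle. Expanded in the distinguished basis, a marking contributes one factor
`-1` for every circle that has canonical marking `b` and is marked `v₊`. -/
noncomputable def canonicalCycle (β : BraidWord n) : Chain β := fun g =>
  if g.1 = braidlikeState β then
    ∏ p : Fin n, if IsMarkedB p ∧ g.mark (0, p) = 1 then -1 else 1
  else 0

/-- The annular Rasmussen invariant `d_t(σ̂, o_↑)` of the closure of the braid word `β`: the
`j_t`-grading of the homology class of the canonical cycle, that is the largest grading of a cycle
representing this class. -/
noncomputable def annularRasmussen (β : BraidWord n) (t : ℝ) : ℝ :=
  sSup (classGradings β t (canonicalCycle β))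

end AnnularLee

namespace AnnularLee

variable {n : ℕ} {β : BraidWord n}

/-! ### The circles of the braid-like resolution -/

/-! In the braid-like resolution every circle is nontrivial, so `k` equals the number of `v₊` minus
the number of `v₋`. In `j - k` the markings cancel, leaving `n₋ + n₊ - 2 n₋ = w`: `j_1` is constant
on all generators over this resolution (`jtGrading_one_of_braidlike`), and the canonical chain has
grading `w`. No homologous cycle does better, because the canonical chain is also a cocycle: the
bilinear pairing with it kills boundaries (`canonicalPairing_leeDifferential`) and is nonzero on the
chain itself. A cycle in the class therefore has a nonzero coefficient at some braid-like generator,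
which caps its grading at `w`. Both the cycle and the cocycle property come from one sign-reversing
involution. The two circles at a crossing carry one `a` and one `b`, so reversing both marks negates
the canonical coefficient, whereas merge and split terms see only the product of the two marks. -/

lemma isVertical_braidlikeState (ℓ : Fin β.length) : IsVertical β (braidlikeState β) ℓ := rfl

lemma leftPos_ne_rightPos (ℓ : Fin β.length) : leftPos β ℓ ≠ rightPos β ℓ := by
  simp [leftPos, rightPos, Fin.ext_iff]

lemma arc_braidlikeState_snd {P Q : Point β} (h : Arc β (braidlikeState β) P Q) : P.2 = Q.2 := by
  cases h with
  | horizontalLower ℓ h => exact absurd (isVertical_braidlikeState ℓ) h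
  | horizontalUpper ℓ h => exact absurd (isVertical_braidlikeState ℓ) h
  | _ => rfl

/-- The position of a circle of the braid-like resolution. -/
def circlePosition (c : StateCircle β (braidlikeState β)) : Fin n :=
  Quot.lift Prod.snd (fun _ _ h => arc_braidlikeState_snd h) c

lemma circleAt_succ_eq (ℓ : Fin β.length) (p : Fin n) :
    circleAt β (braidlikeState β) (ℓ.succ, p) = circleAt β (braidlikeState β) (ℓ.castSucc, p) := by
  refine (Quot.sound ?_).symm
  by_cases hl : p = leftPos β ℓ
  · subst hl
    exact .verticalLeft ℓ (isVertical_braidlikeState ℓ)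
  by_cases hr : p = rightPos β ℓ
  · subst hr
    exact .verticalRight ℓ (isVertical_braidlikeState ℓ)
  exact .strand ℓ p hl hr

lemma circleAt_braidlikeState (i : Fin (β.length + 1)) (p : Fin n) :
    circleAt β (braidlikeState β) (i, p) = circleAt β (braidlikeState β) (0, p) := by
  induction i using Fin.induction with
  | zero => rfl
  | succ ℓ ih => rw [circleAt_succ_eq, ih]

lemma circleAt_braidlikeState_eq_iff {P Q : Point β} :
    circleAt β (braidlikeState β) P = circleAt β (braidlikeState β) Q ↔ P.2 = Q.2 := by
  refine ⟨fun h => congrArg circlePosition h, fun h => ?_⟩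
  obtain ⟨i, p⟩ := P
  obtain ⟨k, q⟩ := Q
  obtain rfl : p = q := h
  rw [circleAt_braidlikeState, circleAt_braidlikeState k]

lemma isNontrivial_braidlikeState (c : StateCircle β (braidlikeState β)) :
    IsNontrivial β (braidlikeState β) c := by
  obtain ⟨⟨i, p⟩, rfl⟩ := Quot.exists_rep c
  have h : {q : Fin n | circleAt β (braidlikeState β) (0, q) =
      circleAt β (braidlikeState β) (i, p)} = {p} := by
    ext q
    simp [circleAt_braidlikeState_eq_iff]
  change Odd (Set.ncard {q : Fin n | circleAt β (braidlikeState β) (0, q) =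
      circleAt β (braidlikeState β) (i, p)})
  rw [h, Set.ncard_singleton]
  exact odd_one

/-! ### Gradings of the braid-like generators -/

lemma card_filter_braidlikeState :
    (Finset.univ.filter fun ℓ => braidlikeState β ℓ = true).card = numNeg β := by
  have h : ∀ γ : BraidWord n,
      (γ.map fun x => if (!x.2) = true then 1 else 0).sum = γ.countP fun x => !x.2 := by
    intro γ
    induction γ with
    | nil => rfl
    | cons x γ ih => rw [List.map_cons, List.sum_cons, ih, List.countP_cons, add_comm]
  rw [Finset.card_filter, numNeg, ← h]
  exact Fin.sum_univ_fun_getElem β fun x => if (!x.2) = true then 1 else 0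

lemma writhe_toBraid (β : BraidWord n) : writhe β.toBraid = numPos β - numNeg β := by
  have h : ∀ γ : BraidWord n, Multiplicative.toAdd (List.prod (γ.map fun x =>
      cond x.2 (Multiplicative.ofAdd (1 : ℤ)) (Multiplicative.ofAdd (1 : ℤ))⁻¹)) =
      numPos γ - numNeg γ := by
    intro γ
    induction γ with
    | nil => rfl
    | cons x γ ih =>
      obtain ⟨i, _ | _⟩ := x <;>
        simp only [numPos, numNeg, List.map_cons, List.prod_cons, toAdd_mul, List.countP_cons]
          at ih ⊢ <;> rw [ih] <;> simp <;> ring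
  rw [← h]
  change Multiplicative.toAdd (FreeGroup.lift (fun _ => Multiplicative.ofAdd (1 : ℤ))
    (FreeGroup.mk β)) = _
  rw [FreeGroup.lift_mk]

/-- Since all circles are nontrivial, the sum of the marks occurs in both `j` and `k` and drops out
at `t = 1`. -/
lemma jtGrading_one_of_braidlike {g : Generator β} (hg : g.1 = braidlikeState β) :
    jtGrading 1 g = (writhe β.toBraid : ℝ) := by
  obtain ⟨s, m⟩ := g
  obtain rfl : s = braidlikeState β := hg
  have hj : jGrading (⟨braidlikeState β, m⟩ : Generator β) =
      kGrading (⟨braidlikeState β, m⟩ : Generator β) + writhe β.toBraid := by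
    rw [writhe_toBraid, jGrading, kGrading, card_filter_braidlikeState]
    simp only [isNontrivial_braidlikeState, if_true]
    ring
  rw [jtGrading, hj]
  push_cast
  ring

/-! ### Reversing the marks at a crossing -/

open Classical in
/-- Reverse the marks of the circles that meet the crossing `ℓ`. -/
noncomputable def flipAt (ℓ : Fin β.length) (g : Generator β) : Generator β :=
  ⟨g.1, fun c => if c = circleAt β g.1 (lowerEnd β ℓ) ∨ c = circleAt β g.1 (upperEnd β ℓ)
    then -g.2 c else g.2 c⟩

lemma flipAt_fst (ℓ : Fin β.length) (g : Generator β) : (flipAt ℓ g).1 = g.1 := rfl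

lemma flipAt_involutive (ℓ : Fin β.length) :
    Function.Involutive (flipAt ℓ : Generator β → Generator β) := by
  rintro ⟨s, m⟩
  classical
  -- Whether a mark is reversed depends only on the state, which the flip preserves, so both flips
  -- test the same `p`.
  have h : ∀ (p : Prop) [Decidable p] (u : ℤˣ),
      (if p then -(if p then -u else u) else (if p then -u else u)) = u := by
    intro p _ u
    split_ifs <;> simp
  exact congrArg (Sigma.mk s) (funext fun c => h _ _)

lemma mark_flipAt_lowerEnd (ℓ : Fin β.length) (g : Generator β) :
    (flipAt ℓ g).mark (lowerEnd β ℓ) = -g.mark (lowerEnd β ℓ) := by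
  simp [flipAt, Generator.mark]

lemma mark_flipAt_upperEnd (ℓ : Fin β.length) (g : Generator β) :
    (flipAt ℓ g).mark (upperEnd β ℓ) = -g.mark (upperEnd β ℓ) := by
  simp [flipAt, Generator.mark]

lemma mark_flipAt_of_ne {ℓ : Fin β.length} {g : Generator β} {P : Point β}
    (hl : circleAt β g.1 P ≠ circleAt β g.1 (lowerEnd β ℓ))
    (hu : circleAt β g.1 P ≠ circleAt β g.1 (upperEnd β ℓ)) :
    (flipAt ℓ g).mark P = g.mark P := by
  simp [flipAt, Generator.mark, hl, hu]

lemma circleAt_lowerEnd_ne_upperEnd {s : State β} (hs : s = braidlikeState β)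
    (ℓ : Fin β.length) : circleAt β s (lowerEnd β ℓ) ≠ circleAt β s (upperEnd β ℓ) := by
  subst hs
  rw [Ne, circleAt_braidlikeState_eq_iff]
  exact leftPos_ne_rightPos ℓ

lemma isMarkedB_iff (p : Fin n) : IsMarkedB p ↔ Even (n - 1 - p : ℕ) := by
  rw [IsMarkedB, ← Fin.card_Ioi]
  congr! 2
  ext q
  simp

lemma isMarkedB_rightPos_iff (ℓ : Fin β.length) :
    IsMarkedB (rightPos β ℓ) ↔ ¬ IsMarkedB (leftPos β ℓ) := by
  rw [isMarkedB_iff, isMarkedB_iff]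
  have h := (rightPos β ℓ).isLt
  simp only [rightPos, leftPos] at h ⊢
  -- The truncated subtraction is harmless because `rightPos` is a position, i.e. its value is below
  -- `n`.
  have heq : n - 1 - ((β.get ℓ).1 : ℕ) = n - 1 - ((β.get ℓ).1 + 1) + 1 := by omega
  rw [heq, Nat.even_add_one, not_not]

/-- Reversing a mark changes the sign of the coefficient on a circle labelled `b` and does nothing
on one labelled `a`. The circles at a crossing are adjacent, so exactly one of them is labelled `b`.
-/
lemma canonicalCycle_flipAt (ℓ : Fin β.length) (g : Generator β) :
    canonicalCycle β (flipAt ℓ g) = -canonicalCycle β g := by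
  classical
  by_cases hg : g.1 = braidlikeState β
  swap
  · simp [canonicalCycle, flipAt_fst, hg]
  have hmark : ∀ p : Fin n, (flipAt ℓ g).mark (0, p) =
      if p = leftPos β ℓ ∨ p = rightPos β ℓ then -g.mark (0, p) else g.mark (0, p) := by
    obtain ⟨s, m⟩ := g
    obtain rfl : s = braidlikeState β := hg
    intro p
    simp only [flipAt, Generator.mark, circleAt_braidlikeState_eq_iff]
    rfl
  have hsign : ∏ p : Fin n, (if IsMarkedB p ∧ (p = leftPos β ℓ ∨ p = rightPos β ℓ)
      then (-1 : ℂ) else 1) = -1 := by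
    by_cases hB : IsMarkedB (leftPos β ℓ)
    · rw [Finset.prod_eq_single (leftPos β ℓ)]
      · simp [hB]
      · rintro p - hp
        rw [if_neg]
        rintro ⟨h, rfl | rfl⟩
        · exact hp rfl
        · exact (isMarkedB_rightPos_iff ℓ).1 h hB
      · simp
    · rw [Finset.prod_eq_single (rightPos β ℓ)]
      · simp [isMarkedB_rightPos_iff, hB]
      · rintro p - hp
        rw [if_neg]
        rintro ⟨h, rfl | rfl⟩
        · exact hB h
        · exact hp rfl
      · simp
  suffices h : canonicalCycle β (flipAt ℓ g) = (∏ p : Fin n,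
      (if IsMarkedB p ∧ (p = leftPos β ℓ ∨ p = rightPos β ℓ) then (-1 : ℂ) else 1)) *
        canonicalCycle β g by
    rw [h, hsign, neg_one_mul]
  have hg' : (flipAt ℓ g).1 = braidlikeState β := hg
  rw [canonicalCycle, canonicalCycle, if_pos hg, if_pos hg', ← Finset.prod_mul_distrib]
  refine Finset.prod_congr rfl fun p _ => ?_
  rw [hmark]
  rcases Int.units_eq_one_or (g.mark (0, p)) with h | h <;>
    by_cases hp : p = leftPos β ℓ ∨ p = rightPos β ℓ <;>
    by_cases hB : IsMarkedB p <;> simp [h, hp, hB]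

/-! ### Edges of the cube at the braid-like resolution -/

/-- An edge leaving the braid-like resolution joins two distinct circles, hence is a merge, and the
product of two marks survives negating both. -/
lemma isEdgeTerm_flipAt_source {ℓ : Fin β.length} {g g' : Generator β}
    (hg : g.1 = braidlikeState β) (h : IsEdgeTerm ℓ g g') : IsEdgeTerm ℓ (flipAt ℓ g) g' := by
  have hne := circleAt_lowerEnd_ne_upperEnd hg ℓ
  obtain ⟨h0, h1, h2, h3⟩ := h
  refine ⟨h0, h1, fun P hl hu => ?_, Or.inl ?_⟩
  · exact (h2 P hl hu).trans (mark_flipAt_of_ne (g := g) hl hu).symm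
  · rcases h3 with h3 | h3
    · refine ⟨hne, h3.2.1, ?_⟩
      rw [mark_flipAt_lowerEnd, mark_flipAt_upperEnd, neg_mul_neg]
      exact h3.2.2
    · exact absurd h3.1 hne

/-- Away from the circles through a crossing, changing its resolution changes no circle. -/
lemma circleAt_eq_of_update {s : State β} {ℓ : Fin β.length} {b : Bool} {P Q : Point β}
    (h : circleAt β (Function.update s ℓ b) P = circleAt β (Function.update s ℓ b) Q) :
    (circleAt β s P = circleAt β s (lowerEnd β ℓ) ∨
      circleAt β s P = circleAt β s (upperEnd β ℓ)) ↔
    (circleAt β s Q = circleAt β s (lowerEnd β ℓ) ∨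
      circleAt β s Q = circleAt β s (upperEnd β ℓ)) := by
  -- `R` holds at all four ends of the crossing, whichever way it is resolved in `s`. Hence `R` is
  -- constant along the arcs of the changed state too, and descends to its circles.
  set R : Point β → Prop := fun P => circleAt β s P = circleAt β s (lowerEnd β ℓ) ∨
      circleAt β s P = circleAt β s (upperEnd β ℓ) with hR
  have hsound : ∀ {P Q : Point β}, Arc β s P Q → circleAt β s P = circleAt β s Q :=
    fun h => Quot.sound h
  have hcongr : ∀ {P Q : Point β}, Arc β s P Q → (R P ↔ R Q) := by
    intro P Q h
    simp only [hR, hsound h]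
  have hll : R (ℓ.castSucc, leftPos β ℓ) := Or.inl rfl
  have hur : R (ℓ.succ, rightPos β ℓ) := Or.inr rfl
  have hends : R (ℓ.castSucc, rightPos β ℓ) ∧ R (ℓ.succ, leftPos β ℓ) := by
    by_cases hv : IsVertical β s ℓ
    · exact ⟨(hcongr (.verticalRight ℓ hv)).2 hur, (hcongr (.verticalLeft ℓ hv)).1 hll⟩
    · exact ⟨(hcongr (.horizontalLower ℓ hv)).1 hll, (hcongr (.horizontalUpper ℓ hv)).2 hur⟩
  have hv : ∀ {k : Fin β.length}, k ≠ ℓ →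
      (IsVertical β (Function.update s ℓ b) k ↔ IsVertical β s k) := by
    intro k hk
    simp [IsVertical, hk]
  have hinv : ∀ P Q : Point β, Arc β (Function.update s ℓ b) P Q → R P = R Q := by
    intro P Q h
    refine propext ?_
    cases h with
    | closing p => exact hcongr (.closing p)
    | strand k p hl hr => exact hcongr (.strand k p hl hr)
    | verticalLeft k h =>
      by_cases hk : k = ℓ
      · subst hk; exact iff_of_true hll hends.2
      · exact hcongr (.verticalLeft k ((hv hk).1 h))
    | verticalRight k h =>
      by_cases hk : k = ℓ
      · subst hk; exact iff_of_true hends.1 hur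
      · exact hcongr (.verticalRight k ((hv hk).1 h))
    | horizontalLower k h =>
      by_cases hk : k = ℓ
      · subst hk; exact iff_of_true hll hends.1
      · exact hcongr (.horizontalLower k (mt (hv hk).2 h))
    | horizontalUpper k h =>
      by_cases hk : k = ℓ
      · subst hk; exact iff_of_true hends.2 hur
      · exact hcongr (.horizontalUpper k (mt (hv hk).2 h))
  exact iff_of_eq (congrArg (Quot.lift R hinv) h)

/-- Dually, an edge entering the braid-like resolution is a split, which constrains only the product
of the two new marks. -/
lemma isEdgeTerm_flipAt_target {ℓ : Fin β.length} {g g' : Generator β}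
    (hg : g'.1 = braidlikeState β) (h : IsEdgeTerm ℓ g g') : IsEdgeTerm ℓ g (flipAt ℓ g') := by
  have hne := circleAt_lowerEnd_ne_upperEnd hg ℓ
  obtain ⟨h0, h1, h2, h3⟩ := h
  refine ⟨h0, h1, fun P hl hu => ?_, Or.inr ?_⟩
  · rw [← h2 P hl hu]
    have hP : ¬ (circleAt β g.1 P = circleAt β g.1 (lowerEnd β ℓ) ∨
        circleAt β g.1 P = circleAt β g.1 (upperEnd β ℓ)) := not_or.2 ⟨hl, hu⟩
    refine mark_flipAt_of_ne (fun h => hP ?_) (fun h => hP ?_) <;> rw [h1] at h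
    · exact (circleAt_eq_of_update h).2 (Or.inl rfl)
    · exact (circleAt_eq_of_update h).2 (Or.inr rfl)
  · rcases h3 with h3 | h3
    · exact absurd h3.2.1 hne
    · refine ⟨h3.1, hne, ?_⟩
      rw [mark_flipAt_lowerEnd, mark_flipAt_upperEnd, neg_mul_neg]
      exact h3.2.2

lemma canonicalCycle_of_ne {g : Generator β} (hg : g.1 ≠ braidlikeState β) :
    canonicalCycle β g = 0 := if_neg hg

lemma sum_eq_zero_of_flipAt {f : Generator β → ℂ} (ℓ : Fin β.length)
    (hf : ∀ g, f (flipAt ℓ g) = -f g) : ∑ g, f g = 0 := by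
  have h : ∑ g, f g = -∑ g, f g := by
    rw [← Finset.sum_neg_distrib,
      ← Equiv.sum_comp (Function.Involutive.toPerm _ (flipAt_involutive ℓ)) f]
    exact Finset.sum_congr rfl fun g _ => hf g
  exact self_eq_neg.1 h

theorem leeDifferential_canonicalCycle : leeDifferential β (canonicalCycle β) = 0 := by
  classical
  funext g'
  change ∑ g, leeCoeff g g' * canonicalCycle β g = 0
  simp only [leeCoeff, Finset.sum_mul]
  rw [Finset.sum_comm]
  -- Cancellation happens for each crossing separately; the cube sign depends only on the state, so
  -- the flip leaves it alone.
  refine Finset.sum_eq_zero fun ℓ _ => sum_eq_zero_of_flipAt ℓ fun g => ?_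
  rw [canonicalCycle_flipAt, mul_neg]
  by_cases hg : g.1 = braidlikeState β
  · have hiff : IsEdgeTerm ℓ (flipAt ℓ g) g' ↔ IsEdgeTerm ℓ g g' :=
      ⟨fun h => by
        simpa [flipAt_involutive ℓ g] using isEdgeTerm_flipAt_source (g := flipAt ℓ g) hg h,
        isEdgeTerm_flipAt_source hg⟩
    exact congrArg (fun a => -(a * canonicalCycle β g)) (if_congr hiff rfl rfl)
  · simp [canonicalCycle_of_ne hg]

/-- The pairing with the canonical cycle, which is also the canonical cocycle. -/
noncomputable def canonicalPairing (β : BraidWord n) : Chain β →ₗ[ℂ] ℂ :=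
  ∑ g, canonicalCycle β g • LinearMap.proj g

lemma canonicalPairing_apply (x : Chain β) :
    canonicalPairing β x = ∑ g, canonicalCycle β g * x g := by
  simp [canonicalPairing]

theorem canonicalPairing_leeDifferential (x : Chain β) :
    canonicalPairing β (leeDifferential β x) = 0 := by
  classical
  rw [canonicalPairing_apply]
  change ∑ g', canonicalCycle β g' * ∑ g, leeCoeff g g' * x g = 0
  simp only [leeCoeff, Finset.sum_mul, Finset.mul_sum]
  rw [Finset.sum_comm]
  refine Finset.sum_eq_zero fun g _ => ?_
  rw [Finset.sum_comm]
  refine Finset.sum_eq_zero fun ℓ _ => sum_eq_zero_of_flipAt ℓ fun g' => ?_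
  rw [canonicalCycle_flipAt, neg_mul]
  by_cases hg : g'.1 = braidlikeState β
  · have hiff : IsEdgeTerm ℓ g (flipAt ℓ g') ↔ IsEdgeTerm ℓ g g' :=
      ⟨fun h => by
        simpa [flipAt_involutive ℓ g'] using isEdgeTerm_flipAt_target (g' := flipAt ℓ g') hg h,
        isEdgeTerm_flipAt_target hg⟩
    simp only [hiff]
  · simp [canonicalCycle_of_ne hg]

lemma canonicalCycle_mul_self {g : Generator β} (hg : g.1 = braidlikeState β) :
    canonicalCycle β g * canonicalCycle β g = 1 := by
  classical
  rw [canonicalCycle, if_pos hg, ← Finset.prod_mul_distrib]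
  refine Finset.prod_eq_one fun p _ => ?_
  split_ifs <;> norm_num

/-- The coefficients are `±1` on the braid-like generators and zero elsewhere, so the self-pairing
counts these generators. -/
theorem canonicalPairing_canonicalCycle_ne_zero :
    canonicalPairing β (canonicalCycle β) ≠ 0 := by
  classical
  have h : canonicalPairing β (canonicalCycle β) =
      ((Finset.univ.filter fun g : Generator β => g.1 = braidlikeState β).card : ℂ) := by
    rw [canonicalPairing_apply, Finset.card_filter, Nat.cast_sum]
    refine Finset.sum_congr rfl fun g _ => ?_
    by_cases hg : g.1 = braidlikeState β
    · simp [hg, canonicalCycle_mul_self hg]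
    · simp [hg, canonicalCycle_of_ne hg]
  rw [h, Nat.cast_ne_zero]
  exact Finset.card_ne_zero_of_mem (a := (⟨braidlikeState β, fun _ => 1⟩ : Generator β)) (by simp)

/-! ### The filtration -/

/-- The filtration is spanned by basis vectors, so membership is a condition on the support. -/
lemma mem_filtration_iff {t a : ℝ} {x : Chain β} :
    x ∈ filtration β t a ↔ ∀ g, x g ≠ 0 → a ≤ jtGrading t g := by
  classical
  constructor
  · intro hx
    induction hx using Submodule.span_induction with
    | mem x hx =>
      obtain ⟨g, hg, rfl⟩ := hx
      intro g' hg'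
      by_cases h : g' = g
      · rwa [h]
      · exact absurd (Pi.single_eq_of_ne h _) hg'
    | zero => intro g hg; exact absurd rfl hg
    | add x y _ _ hx hy =>
      intro g hg
      by_cases h : x g = 0
      · refine hy g fun h' => hg ?_
        simp [h, h']
      · exact hx g h
    | smul c x _ hx =>
      intro g hg
      refine hx g fun h => hg ?_
      simp [h]
  · intro h
    rw [pi_eq_sum_univ' x]
    refine Submodule.sum_mem _ fun g _ => ?_
    by_cases hg : x g = 0
    · simp [hg]
    · refine Submodule.smul_mem _ _ (Submodule.subset_span ⟨g, h g hg, ?_⟩)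
      funext g'
      simp [Pi.single_apply, eq_comm]

lemma exists_mem_filtration (t : ℝ) (x : Chain β) : ∃ a, x ∈ filtration β t a := by
  obtain ⟨a, ha⟩ := (Set.finite_range (jtGrading (β := β) t)).bddBelow
  exact ⟨a, mem_filtration_iff.2 fun g _ => ha ⟨g, rfl⟩⟩

lemma chainGrading_le_writhe {x : Chain β} (hx : canonicalPairing β x ≠ 0) :
    chainGrading β 1 x ≤ writhe β.toBraid := by
  refine csSup_le (exists_mem_filtration 1 x) fun a ha => ?_
  rw [canonicalPairing_apply] at hx
  obtain ⟨g, -, hg⟩ := Finset.exists_ne_zero_of_sum_ne_zero hx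
  have hs : g.1 = braidlikeState β := by
    by_contra h
    exact left_ne_zero_of_mul hg (canonicalCycle_of_ne h)
  rw [← jtGrading_one_of_braidlike hs]
  exact mem_filtration_iff.1 ha g (right_ne_zero_of_mul hg)

lemma chainGrading_canonicalCycle :
    chainGrading β 1 (canonicalCycle β) = writhe β.toBraid := by
  refine le_antisymm (chainGrading_le_writhe canonicalPairing_canonicalCycle_ne_zero) ?_
  have hmem : canonicalCycle β ∈ filtration β 1 (writhe β.toBraid) := by
    refine mem_filtration_iff.2 fun g hg => ?_
    have hs : g.1 = braidlikeState β := by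
      by_contra h
      exact hg (canonicalCycle_of_ne h)
    exact (jtGrading_one_of_braidlike hs).ge
  -- The supremum needs an upper bound: any generator in the support gives one, here the braid-like
  -- one with all marks `v₊`.
  refine le_csSup ⟨jtGrading 1 (⟨braidlikeState β, fun _ => 1⟩ : Generator β), fun a ha => ?_⟩ hmem
  have hg : (⟨braidlikeState β, fun _ => 1⟩ : Generator β).1 = braidlikeState β := rfl
  refine mem_filtration_iff.1 ha _ fun h => ?_
  simpa [h] using canonicalCycle_mul_self hg

theorem isGreatest_classGradings :
    IsGreatest (classGradings β 1 (canonicalCycle β)) (writhe β.toBraid : ℝ) := by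
  constructor
  · exact ⟨canonicalCycle β, leeDifferential_canonicalCycle, by simp,
      chainGrading_canonicalCycle⟩
  · rintro r ⟨z, -, ⟨y, hy⟩, rfl⟩
    refine chainGrading_le_writhe ?_
    -- `z` differs from the canonical cycle by a boundary, so the two have the same nonzero pairing.
    have h := canonicalPairing_leeDifferential y
    rw [hy, map_sub, sub_eq_zero] at h
    rw [h]
    exact canonicalPairing_canonicalCycle_ne_zero

end AnnularLee

/-- For every braid `σ ∈ B_n` and every word `β` representing it, `d_1(σ̂, o_↑)` is the writhe of `σ`.
The first three conjuncts say that this value is meaningful: the canonical chain is a cycle, its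
Lee homology class is nonzero, and the largest grading of a representative exists. -/
theorem theorem5p7 (n : ℕ) (σ : AnnularLee.BraidGroup n) (β : AnnularLee.BraidWord n)
    (hβ : β.toBraid = σ) :
    AnnularLee.leeDifferential β (AnnularLee.canonicalCycle β) = 0 ∧
    AnnularLee.canonicalCycle β ∉ LinearMap.range (AnnularLee.leeDifferential β) ∧
    IsGreatest (AnnularLee.classGradings β 1 (AnnularLee.canonicalCycle β))
      (AnnularLee.annularRasmussen β 1) ∧
    AnnularLee.annularRasmussen β 1 = (AnnularLee.writhe σ : ℝ) := by
  subst hβ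
  have hgr := AnnularLee.isGreatest_classGradings (β := β)
  have hd : AnnularLee.annularRasmussen β 1 = (AnnularLee.writhe β.toBraid : ℝ) := hgr.csSup_eq
  refine ⟨AnnularLee.leeDifferential_canonicalCycle, ?_, hd ▸ hgr, hd⟩
  rintro ⟨y, hy⟩
  exact AnnularLee.canonicalPairing_canonicalCycle_ne_zero
    (hy ▸ AnnularLee.canonicalPairing_leeDifferential y)
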